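/- Let $p,q$ be strictly positive differentiable probability densities on $\mathbb{R}^D$ with $q(x)\to 0$ as $\|x\|\to\infty$, and let $s_p=\nabla\log p$, $s_q=\nabla\log q$ be their scores; for a unit vector $r\in\mathbb{S}^{D-1}$ put $s_p^r=s_p^Tr$, $s_q^r=s_q^Tr$. Assume that $s_p^r-s_q^r$ belongs to $L^1(q\,dx)$ and to $L^2(q\,dx)$ for every $r\in\mathbb{S}^{D-1}$. For all $r,g\in\mathbb{S}^{D-1}$ let $\mathcal{H}_{rg}$ be a reproducing kernel Hilbert space of real functions on $\mathbb{R}$ with kernel $k_{rg}$ such that (i) $k_{rg}$ is $C_0$-universal, i.e. $\mathcal{H}_{rg}\subset C_0(\mathbb{R})$ and $\mathcal{H}_{rg}$ is dense in $C_0(\mathbb{R})$ for the supremum norm; (ii) the kernel $k(x,x')=k_{rg}(x^Tg,x'^Tg)$ on $\mathbb{R}^D$ is in the Stein class of $q$: it has continuous second order partial derivatives and, for each fixed $x$, the functions $f=k(x,\cdot)$ and $f=k(\cdot,x)$ are continuously differentiable with $\nabla(fq)$ Lebesgue integrable and $\int_{\mathbb{R}^D}\nabla(fq)\,dx=0$;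 (iii) $\sup_x k_{rg}(x^Tg,x^Tg)<\infty$; (iv) $\mathbb{E}_q[h_{p,r,g}(x,x)]<\infty$, where $$h_{p,r,g}(x,y)=s_p^r(x)s_p^r(y)\,k_{rg}(s,t)+r^Tg\,s_p^r(y)\,\partial_sk_{rg}(s,t)+r^Tg\,s_p^r(x)\,\partial_tk_{rg}(s,t)+(r^Tg)^2\,\partial_s\partial_tk_{rg}(s,t)$$ with $s=x^Tg$ and $t=y^Tg$. Put $$D^2_{rg}(q,p)=\Big(\sup_{f\in\mathcal{H}_{rg},\ \|f\|\le1}\mathbb{E}_{x\sim q}\big[s_p^r(x)f(x^Tg)+r^Tg\,f'(x^Tg)\big]\Big)^2 .$$ Let $O_r$ be an orthonormal basis of $\mathbb{R}^D$ and let $p_g$ be the uniform probability distribution on $\mathbb{S}^{D-1}$. Assume that $g\mapsto D^2_{rg}(q,p)$ is $p_g$-measurable for each $r\in O_r$, so that $$SK_o(q,p)=\sum_{r\in O_r}\int_{\mathbb{S}^{D-1}}D^2_{rg}(q,p)\,dp_g(g)\in[0,\infty]$$ is defined. Then $SK_o(q,p)=0$ if and only if $p=q$ almost everywhere. -/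

import Mathlib

open MeasureTheory Filter Topology
open scoped ENNReal Gradient ZeroAtInfty

noncomputable section

/-- `ℝ^D` with its Euclidean norm. -/
abbrev Euc (D : ℕ) : Type := EuclideanSpace ℝ (Fin D)

/-- The unit sphere `𝕊^{D-1}` of `ℝ^D`. -/
abbrev USphere (D : ℕ) : Type := Metric.sphere (0 : Euc D) 1

/-- `q` is a continuous, differentiable probability density supported on all of `ℝ^D`. -/
structure IsDiffPosDensity {D : ℕ} (q : Euc D → ℝ) : Prop where
  pos : ∀ x, 0 < q x
  differentiable : Differentiable ℝ q
  integrable : Integrable q volume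
  integral_eq_one : ∫ x, q x = 1

/-- The probability measure `q(x) dx`. -/
def densityMeasure {D : ℕ} (q : Euc D → ℝ) : Measure (Euc D) :=
  volume.withDensity (fun x => ENNReal.ofReal (q x))

/-- The score `s_p(x) = ∇ log p(x)`. -/
def score {D : ℕ} (p : Euc D → ℝ) (x : Euc D) : Euc D :=
  ∇ (fun y => Real.log (p y)) x

/-- The projected score `s_p^r(x) = s_p(x)ᵀ r`. -/
def projScore {D : ℕ} (p : Euc D → ℝ) (r : USphere D) (x : Euc D) : ℝ :=
  inner ℝ (score p x) (r : Euc D)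

/-- `f` is in the Stein class of `q`: it is smooth (continuously differentiable) and
`∫ ∇(f q) dx = 0`, the integral being an absolutely convergent one. -/
def InSteinClass {D : ℕ} (q f : Euc D → ℝ) : Prop :=
  ContDiff ℝ 1 f ∧
  Integrable (fun x => ∇ (fun y => f y * q y) x) volume ∧
  ∫ x, ∇ (fun y => f y * q y) x = 0

/-- A kernel `K` on `ℝ^D` is in the Stein class of `q`: it has continuous second order partial
derivatives, and all `K(x, ·)` and `K(·, x)` are in the Stein class of `q`. -/
def KernelInSteinClass {D : ℕ} (q : Euc D → ℝ) (K : Euc D → Euc D → ℝ) : Prop :=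
  ContDiff ℝ 2 (fun z : Euc D × Euc D => K z.1 z.2) ∧
  ∀ x, InSteinClass q (fun y => K x y) ∧ InSteinClass q (fun y => K y x)

/-- The scalar reproducing kernel `k(s, t)` of an RKHS of real functions on `ℝ`. -/
def scalarKernel (H : Type*) [NormedAddCommGroup H] [InnerProductSpace ℝ H] [CompleteSpace H]
    [RKHS ℝ H ℝ ℝ] (s t : ℝ) : ℝ :=
  RKHS.kernel H s t 1

/-- The kernel of `H` is `C₀`-universal: `H` consists of continuous functions vanishing at
infinity, and is dense in `C₀(ℝ)` for the supremum norm. -/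
def IsC0Universal (H : Type*) [NormedAddCommGroup H] [InnerProductSpace ℝ H]
    [RKHS ℝ H ℝ ℝ] : Prop :=
  (∀ f : H, ∃ F : C₀(ℝ, ℝ), ∀ t, F t = f t) ∧
  Dense {F : C₀(ℝ, ℝ) | ∃ f : H, ∀ t, F t = f t}

/-- The function `h_{p,r,g}(x, y)` built from a scalar kernel `k`. -/
def steinKernel {D : ℕ} (p : Euc D → ℝ) (r g : USphere D) (k : ℝ → ℝ → ℝ) (x y : Euc D) : ℝ :=
  let s : ℝ := inner ℝ x (g : Euc D)
  let t : ℝ := inner ℝ y (g : Euc D)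
  let c : ℝ := inner ℝ (r : Euc D) (g : Euc D)
  projScore p r x * k s t * projScore p r y
    + c * projScore p r y * deriv (fun a => k a t) s
    + c * projScore p r x * deriv (fun b => k s b) t
    + c ^ 2 * deriv (fun b => deriv (fun a => k a b) s) t

/-- `D²_{rg}(q, p)`: the square of the supremum, over `f` in the unit ball of `H`, of
`E_q[s_p^r(x) f(xᵀg) + (rᵀg) f'(xᵀg)]`. -/
def discSq {D : ℕ} (q p : Euc D → ℝ) (r g : USphere D) (H : Type*) [NormedAddCommGroup H]
    [InnerProductSpace ℝ H] [RKHS ℝ H ℝ ℝ] : ℝ :=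
  (⨆ f : Metric.closedBall (0 : H) 1,
    ∫ x, (projScore p r x * (f : H) (inner ℝ x (g : Euc D))
      + inner ℝ (r : Euc D) (g : Euc D) * deriv (⇑(f : H)) (inner ℝ x (g : Euc D)))
      ∂(densityMeasure q)) ^ 2

/-- The uniform probability distribution on the unit sphere. -/
def sphereUniform (D : ℕ) : Measure (USphere D) :=
  ((volume : Measure (Euc D)).toSphere Set.univ)⁻¹ • (volume : Measure (Euc D)).toSphere

/-- A member of an orthonormal basis, as a point of the unit sphere. -/
def basisDir {D : ℕ} (O : OrthonormalBasis (Fin D) ℝ (Euc D)) (i : Fin D) : USphere D :=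
  ⟨O i, by simp⟩

/-- `SK_o(q, p)`: the sum over the basis of the average over `g` of `D²_{rg}(q, p)`, as an element
of `[0, ∞]`. -/
def SKo {D : ℕ} (O : OrthonormalBasis (Fin D) ℝ (Euc D)) (q p : Euc D → ℝ)
    (H : USphere D → USphere D → Type*) [∀ r g, NormedAddCommGroup (H r g)]
    [∀ r g, InnerProductSpace ℝ (H r g)] [∀ r g, RKHS ℝ (H r g) ℝ ℝ] : ℝ≥0∞ :=
  ∑ i, ∫⁻ g, ENNReal.ofReal (discSq q p (basisDir O i) g (H (basisDir O i) g))
    ∂(sphereUniform D)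

end

/-!
Integration by parts against `q` shows that the Stein operator of `q` has `q`-mean zero, so for
`f` in the RKHS `H` the expectation defining `D²_{rg}(q, p)` equals `E_q[(s_p^r - s_q^r) f(xᵀg)]`.
Hence `D²_{rg}(q, p)` is the squared norm of the mean embedding of `s_p^r - s_q^r` into `H`. A
kernel of class `C²` has a differentiable feature map, so this is an identity of Bochner integrals
of `H`-valued functions; their integrability is the finiteness of `E_q[h_{p,r,g}(x, x)]`.

If `SK_o` vanishes then, for each `r` in the basis, the mean embedding is zero for a dense set of
directions `g`. By `C₀`-universality the signed measure `(s_p^r - s_q^r) q dx` then has vanishing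
projections onto these directions, and it is zero because a finite measure is determined by its
projections onto a dense set of directions (its characteristic function is continuous). Thus
`log p - log q` is a differentiable function whose gradient vanishes almost everywhere. Such a
function is constant, and normalisation gives `p = q`.
-/

theorem norm_mixedDifference_sub_le {F : Type*} [NormedAddCommGroup F] [NormedSpace ℝ F]
    {k k₁ k₁₂ : ℝ → ℝ → F} {A B : Set ℝ} (hA : Convex ℝ A) (hB : Convex ℝ B)
    (hk₁ : ∀ a ∈ A, ∀ b ∈ B, HasDerivAt (fun a => k a b) (k₁ a b) a)
    (hk₁₂ : ∀ a ∈ A, ∀ b ∈ B, HasDerivAt (k₁ a) (k₁₂ a b) b) {M : F} {ε : ℝ}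
    (hM : ∀ a ∈ A, ∀ b ∈ B, ‖k₁₂ a b - M‖ ≤ ε) {a a' b b' : ℝ} (ha : a ∈ A) (ha' : a' ∈ A)
    (hb : b ∈ B) (hb' : b' ∈ B) :
    ‖k a' b' - k a' b - (k a b' - k a b) - ((a' - a) * (b' - b)) • M‖ ≤
      ε * |b' - b| * |a' - a| := by
  have hinner : ∀ x ∈ A, ‖k₁ x b' - k₁ x b - (b' - b) • M‖ ≤ ε * |b' - b| := by
    intro x hx
    have := hB.norm_image_sub_le_of_norm_hasDerivWithin_le
      (f := fun y => k₁ x y - y • M) (f' := fun y => k₁₂ x y - M)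
      (fun y hy => ((hk₁₂ x hx y hy).sub
        (by simpa using (hasDerivAt_id y).smul_const M)).hasDerivWithinAt) (hM x hx) hb hb'
    rwa [sub_sub_sub_comm, ← sub_smul] at this
  have := hA.norm_image_sub_le_of_norm_hasDerivWithin_le
    (f := fun x => k x b' - k x b - x • (b' - b) • M)
    (f' := fun x => k₁ x b' - k₁ x b - (b' - b) • M)
    (fun x hx => (((hk₁ x hx b' hb').sub (hk₁ x hx b hb)).sub
      (by simpa using (hasDerivAt_id x).smul_const ((b' - b) • M))).hasDerivWithinAt)
    hinner ha ha'
  rwa [sub_sub_sub_comm, ← sub_smul, smul_smul] at this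

theorem tendsto_mixedDifferenceQuotient {F : Type*} [NormedAddCommGroup F] [NormedSpace ℝ F]
    {k : ℝ → ℝ → F} (hk : ContDiff ℝ 2 k.uncurry) (a b : ℝ) :
    Tendsto (fun h : ℝ × ℝ => (h.1 * h.2)⁻¹ •
        (k (a + h.1) (b + h.2) - k (a + h.1) b - (k a (b + h.2) - k a b)))
      (𝓝[≠] 0 ×ˢ 𝓝[≠] 0) (𝓝 (deriv (fun y => deriv (fun x => k x y) a) b)) := by
  set k₁ : ℝ → ℝ → F := fun x y => fderiv ℝ k.uncurry (x, y) (1, 0)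
  have hk₁ : ContDiff ℝ 1 k₁.uncurry := (hk.fderiv_right le_rfl).clm_apply contDiff_const
  set k₁₂ : ℝ → ℝ → F := fun x y => fderiv ℝ k₁.uncurry (x, y) (0, 1)
  have hk₁₂ : Continuous k₁₂.uncurry :=
    ((hk₁.fderiv_right (m := 0) le_rfl).clm_apply contDiff_const).continuous
  have hd₁ x y : HasDerivAt (fun x => k x y) (k₁ x y) x :=
    (hk.differentiable two_ne_zero (x, y)).hasFDerivAt.comp_hasDerivAt (l := k.uncurry) x
      ((hasDerivAt_id x).prodMk (hasDerivAt_const x y))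
  have hd₁₂ x y : HasDerivAt (k₁ x) (k₁₂ x y) y :=
    (hk₁.differentiable one_ne_zero (x, y)).hasFDerivAt.comp_hasDerivAt (l := k₁.uncurry) y
      ((hasDerivAt_const y x).prodMk (hasDerivAt_id y))
  rw [funext fun y => (hd₁ a y).deriv, (hd₁₂ a b).deriv, Metric.tendsto_nhds]
  intro ε hε
  obtain ⟨δ, hδ, hclose⟩ :=
    Metric.continuousAt_iff.1 (hk₁₂.continuousAt (x := (a, b))) (ε / 2) (half_pos hε)
  have hball : ∀ᶠ h in 𝓝[≠] (0 : ℝ), |h| < δ ∧ h ≠ 0 :=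
    (eventually_nhdsWithin_of_eventually_nhds
      (by simpa using eventually_abs_sub_lt (0 : ℝ) hδ)).and self_mem_nhdsWithin
  filter_upwards [hball.prod_mk hball] with ⟨h, h'⟩ ⟨⟨hh, h0⟩, hh', h0'⟩
  have hbound := norm_mixedDifference_sub_le (convex_ball a δ) (convex_ball b δ)
    (fun x _ y _ => hd₁ x y) (fun x _ y _ => hd₁₂ x y) (M := k₁₂ a b) (ε := ε / 2)
    (fun x hx y hy => dist_eq_norm (k₁₂ x y) _ ▸ (hclose (x := (x, y)) (max_lt hx hy)).le)
    (Metric.mem_ball_self hδ) (a' := a + h) (by simpa [Real.dist_eq] using hh)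
    (Metric.mem_ball_self hδ) (b' := b + h') (by simpa [Real.dist_eq] using hh')
  simp only [add_sub_cancel_left] at hbound
  have hpos : 0 < |h * h'| := by positivity
  rw [dist_eq_norm, ← inv_smul_smul₀ (mul_ne_zero h0 h0') (k₁₂ a b), ← smul_sub, norm_smul,
    norm_inv, Real.norm_eq_abs, inv_mul_lt_iff₀ hpos]
  refine hbound.trans_lt ?_
  rw [mul_assoc, mul_comm |h'|, ← abs_mul, mul_comm]
  gcongr
  exact half_lt_self hε

theorem cauchy_map_of_tendsto_inner {𝕜 E ι : Type*} [RCLike 𝕜] [NormedAddCommGroup E]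
    [InnerProductSpace 𝕜 E] {l : Filter ι} [l.NeBot] {f : ι → E} {c : 𝕜}
    (h : Tendsto (fun i : ι × ι => inner 𝕜 (f i.1) (f i.2)) (l ×ˢ l) (𝓝 c)) :
    Cauchy (map f l) := by
  have hre {u : ι × ι → ι × ι} (hu : Tendsto u (l ×ˢ l) (l ×ˢ l)) :
      Tendsto (fun i => RCLike.re (inner 𝕜 (f (u i).1) (f (u i).2))) (l ×ˢ l)
        (𝓝 (RCLike.re c)) :=
    (RCLike.continuous_re.tendsto c).comp (h.comp hu)
  have hsq : Tendsto (fun i : ι × ι => ‖f i.1 - f i.2‖ ^ 2) (l ×ˢ l) (𝓝 0) := by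
    have := ((hre (tendsto_fst.prodMk tendsto_fst)).sub ((hre tendsto_id).const_mul 2)).add
      (hre (tendsto_snd.prodMk tendsto_snd))
    simp only [inner_self_eq_norm_sq, id_eq, ← norm_sub_sq] at this
    convert! this using 2
    ring
  rw [cauchy_map_iff', tendsto_uniformity_iff_dist_tendsto_zero]
  simpa [dist_eq_norm] using hsq.sqrt

theorem differentiable_of_contDiff_inner {H : Type*} [NormedAddCommGroup H]
    [InnerProductSpace ℝ H] [CompleteSpace H] {κ : ℝ → H}
    (hκ : ContDiff ℝ 2 (Function.uncurry fun s t => inner ℝ (κ s) (κ t))) :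
    Differentiable ℝ κ := by
  intro s
  -- The inner product of two difference quotients of `κ` is a mixed second difference quotient of
  -- the kernel, so it converges when both increments tend to `0` independently.
  have hinner := tendsto_mixedDifferenceQuotient hκ s s
  have hcauchy : Cauchy (map (fun h => h⁻¹ • (κ (s + h) - κ s)) (𝓝[≠] 0)) := by
    refine cauchy_map_of_tendsto_inner (𝕜 := ℝ) (hinner.congr fun h => ?_)
    simp only [real_inner_smul_left, real_inner_smul_right, inner_sub_left, inner_sub_right,
      smul_eq_mul, mul_inv]
    ring
  obtain ⟨d, hd⟩ := CompleteSpace.complete hcauchy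
  exact (hasDerivAt_iff_tendsto_slope_zero.2 hd).differentiableAt

theorem eq_of_deriv_ae_eq_zero {F : Type*} [NormedAddCommGroup F] [NormedSpace ℝ F]
    [CompleteSpace F] {u : ℝ → F} (hu : Differentiable ℝ u) (h0 : deriv u =ᵐ[volume] 0) (a b : ℝ) :
    u a = u b := by
  have hint : IntervalIntegrable (deriv u) volume b a :=
    (intervalIntegrable_const (c := (0 : F))).congr_ae (ae_restrict_of_ae h0.symm)
  rw [← sub_eq_zero, ← intervalIntegral.integral_deriv_eq_sub (fun t _ => hu t) hint,
    intervalIntegral.integral_congr_ae (g := fun _ => 0) (h0.mono fun t ht _ => ht),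
    intervalIntegral.integral_zero]

theorem eq_of_fderiv_ae_eq_zero {E F : Type*} [NormedAddCommGroup E] [NormedSpace ℝ E]
    [FiniteDimensional ℝ E] [MeasurableSpace E] [BorelSpace E] [NormedAddCommGroup F]
    [NormedSpace ℝ F] [CompleteSpace F] {μ : Measure E} [μ.IsAddHaarMeasure] {u : E → F}
    (hu : Differentiable ℝ u) (h0 : fderiv ℝ u =ᵐ[μ] 0) (x y : E) : u x = u y := by
  suffices htranslate : ∀ v : E, (fun x => u (x + v)) = u by
    simpa using congrFun (htranslate (x - y)) y
  intro v
  refine (Continuous.ae_eq_iff_eq μ (hu.continuous.comp (by fun_prop)) hu.continuous).1 ?_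
  have hmeas : MeasurableSet {z : E × ℝ | fderiv ℝ u (z.1 + z.2 • v) = 0} :=
    ((measurable_fderiv ℝ u).comp (by fun_prop : Measurable fun z : E × ℝ => z.1 + z.2 • v))
      (measurableSet_singleton 0)
  -- By Fubini, almost every line in the direction `v` meets the exceptional set in a null set.
  have hlines : ∀ᵐ x ∂μ, ∀ᵐ t : ℝ, fderiv ℝ u (x + t • v) = 0 :=
    (Measure.ae_ae_comm hmeas).2 <| .of_forall fun t =>
      (quasiMeasurePreserving_add_right μ (t • v)).ae h0
  filter_upwards [hlines] with x hx
  have hderiv (t : ℝ) : HasDerivAt (fun t : ℝ => u (x + t • v)) (fderiv ℝ u (x + t • v) v) t :=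
    (hu _).hasFDerivAt.comp_hasDerivAt t
      (by simpa using ((hasDerivAt_id t).smul_const v).const_add x)
  simpa using eq_of_deriv_ae_eq_zero (fun t => (hderiv t).differentiableAt)
    (hx.mono fun t ht => by simp [(hderiv t).deriv, ht]) 1 0

theorem charFun_smul_eq_charFun_map_inner {E : Type*} [NormedAddCommGroup E]
    [InnerProductSpace ℝ E] [MeasurableSpace E] [OpensMeasurableSpace E] (μ : Measure E) (g : E)
    (t : ℝ) : charFun μ (t • g) = charFun (μ.map fun x => inner ℝ x g) t := by
  rw [funext fun x => real_inner_comm g x]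
  rw [charFun_eq_charFunDual_toDualMap, map_smul]
  exact (charFun_map_eq_charFunDual_smul (innerSL ℝ g) t).symm

theorem dense_image_smul_of_dense_sphere {E : Type*} [NormedAddCommGroup E] [NormedSpace ℝ E]
    [Nontrivial E] {G : Set (Metric.sphere (0 : E) 1)} (hG : Dense G) :
    Dense ((fun z : ℝ × Metric.sphere (0 : E) 1 => z.1 • (z.2 : E)) '' Set.univ ×ˢ G) := by
  refine DenseRange.dense_image (Function.Surjective.denseRange fun x => ?_) (by fun_prop)
    (dense_univ.prod hG)
  obtain rfl | hx := eq_or_ne x 0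
  · exact ⟨(0, Classical.choice (NormedSpace.sphere_nonempty.2 zero_le_one).to_subtype),
      zero_smul ℝ _⟩
  · exact ⟨(‖x‖, ⟨‖x‖⁻¹ • x, by simp [norm_smul, hx]⟩), by simp [smul_smul, hx]⟩

theorem measure_eq_of_map_inner_eq_of_dense {E : Type*} [NormedAddCommGroup E]
    [InnerProductSpace ℝ E] [CompleteSpace E] [SecondCountableTopology E] [Nontrivial E]
    [MeasurableSpace E] [BorelSpace E] {μ ν : Measure E} [IsFiniteMeasure μ]
    [IsFiniteMeasure ν] {G : Set (Metric.sphere (0 : E) 1)} (hG : Dense G)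
    (h : ∀ g ∈ G, (μ.map fun x => inner ℝ x (g : E)) = ν.map fun x => inner ℝ x (g : E)) :
    μ = ν := by
  refine Measure.ext_of_charFun <| Continuous.ext_on (dense_image_smul_of_dense_sphere hG)
    continuous_charFun continuous_charFun ?_
  rintro _ ⟨⟨t, g⟩, ⟨-, hg⟩, rfl⟩
  simp only [charFun_smul_eq_charFun_map_inner, h g hg]

section WeightedIntegral

variable {α : Type*} [MeasurableSpace α] {μ : Measure α} {w : α → ℝ}

theorem ae_eq_zero_of_withDensity_ofReal_eq [SigmaFinite μ] (hw : AEMeasurable w μ)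
    (h : μ.withDensity (fun x => ENNReal.ofReal (w x)) =
      μ.withDensity fun x => ENNReal.ofReal (-w x)) : w =ᵐ[μ] 0 := by
  filter_upwards [(withDensity_eq_iff_of_sigmaFinite hw.ennreal_ofReal
    hw.neg.ennreal_ofReal).1 h] with x hx
  have hparts : max (w x) 0 = max (-w x) 0 := by
    simpa only [ENNReal.toReal_ofReal', Pi.neg_apply] using congrArg ENNReal.toReal hx
  rw [Pi.zero_apply, ← max_zero_sub_max_neg_zero_eq_self (w x), hparts, sub_self]

variable {X : Type*} [TopologicalSpace X] [MeasurableSpace X] [OpensMeasurableSpace X] {T : α → X}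

theorem integrable_mul_zeroAtInfty_comp (hw : Integrable w μ) (hT : Measurable T) (F : C₀(X, ℝ)) :
    Integrable (fun x => w x * F (T x)) μ :=
  hw.mul_bdd (c := ‖F.toBCF‖) ((map_continuous F).measurable.comp hT).aestronglyMeasurable
    (.of_forall fun _ => F.toBCF.norm_coe_le_norm _)

theorem integral_mul_zeroAtInfty_comp_eq_zero_of_dense (hw : Integrable w μ) (hT : Measurable T)
    {S : Set C₀(X, ℝ)} (hS : Dense S) (h : ∀ F ∈ S, ∫ x, w x * F (T x) ∂μ = 0) (F : C₀(X, ℝ)) :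
    ∫ x, w x * F (T x) ∂μ = 0 := by
  suffices hlip : LipschitzWith (∫ x, ‖w x‖ ∂μ).toNNReal
      fun F : C₀(X, ℝ) => ∫ x, w x * F (T x) ∂μ from
    congrFun (Continuous.ext_on hS hlip.continuous continuous_const h) F
  refine LipschitzWith.of_dist_le_mul fun F F' => ?_
  rw [Real.coe_toNNReal _ (integral_nonneg fun _ => norm_nonneg _), dist_eq_norm,
    ← integral_sub (integrable_mul_zeroAtInfty_comp hw hT F)
      (integrable_mul_zeroAtInfty_comp hw hT F'), ← integral_mul_const]
  refine norm_integral_le_of_norm_le (hw.norm.mul_const _) (.of_forall fun x => ?_)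
  rw [← mul_sub, norm_mul, ← dist_eq_norm (F _)]
  gcongr
  exact BoundedContinuousFunction.dist_coe_le_dist (f := F.toBCF) (g := F'.toBCF) _

theorem integral_map_withDensity_ofReal {ψ : α → ℝ} (hψ : AEMeasurable ψ μ) (hT : Measurable T)
    {f : X → ℝ} (hf : Continuous f) :
    ∫ y, f y ∂(μ.withDensity fun x => ENNReal.ofReal (ψ x)).map T =
      ∫ x, max (ψ x) 0 * f (T x) ∂μ := by
  rw [integral_map hT.aemeasurable hf.stronglyMeasurable.aestronglyMeasurable,
    integral_withDensity_eq_integral_toReal_smul₀ hψ.ennreal_ofReal (by simp)]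
  simp only [ENNReal.toReal_ofReal', smul_eq_mul]

theorem map_withDensity_ofReal_eq_of_integral_mul_comp_eq_zero {X : Type*} [MetricSpace X]
    [ProperSpace X] [MeasurableSpace X] [BorelSpace X] {T : α → X} (hw : Integrable w μ)
    (hT : Measurable T) (h : ∀ F : C₀(X, ℝ), ∫ x, w x * F (T x) ∂μ = 0) :
    (μ.withDensity fun x => ENNReal.ofReal (w x)).map T =
      (μ.withDensity fun x => ENNReal.ofReal (-w x)).map T := by
  have := isFiniteMeasure_withDensity_ofReal hw.2
  have : IsFiniteMeasure (μ.withDensity fun x => ENNReal.ofReal (-w x)) :=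
    isFiniteMeasure_withDensity_ofReal hw.neg.2
  refine Measure.ext_of_integral_eq_on_compactlySupported fun f => ?_
  let F : C₀(X, ℝ) := ⟨f.toContinuousMap, f.hasCompactSupport.is_zero_at_infty⟩
  change ∫ y, F y ∂_ = ∫ y, F y ∂_
  rw [integral_map_withDensity_ofReal hw.aemeasurable hT (map_continuous F),
    integral_map_withDensity_ofReal hw.aemeasurable.fun_neg hT (map_continuous F), ← sub_eq_zero,
    ← integral_sub (integrable_mul_zeroAtInfty_comp hw.pos_part hT F)
      (integrable_mul_zeroAtInfty_comp hw.fun_neg.pos_part hT F)]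
  refine Eq.trans ?_ (h F)
  congr 1 with x
  rw [← sub_mul, max_zero_sub_max_neg_zero_eq_self]

end WeightedIntegral

theorem ae_eq_zero_of_integral_mul_ridge_eq_zero {E : Type*} [NormedAddCommGroup E]
    [InnerProductSpace ℝ E] [CompleteSpace E] [SecondCountableTopology E] [Nontrivial E]
    [MeasurableSpace E] [BorelSpace E] {μ : Measure E} [SigmaFinite μ] {w : E → ℝ}
    (hw : Integrable w μ) {G : Set (Metric.sphere (0 : E) 1)} (hG : Dense G)
    (h : ∀ g ∈ G, ∀ F : C₀(ℝ, ℝ), ∫ x, w x * F (inner ℝ x (g : E)) ∂μ = 0) : w =ᵐ[μ] 0 := by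
  have := isFiniteMeasure_withDensity_ofReal hw.2
  have : IsFiniteMeasure (μ.withDensity fun x => ENNReal.ofReal (-w x)) :=
    isFiniteMeasure_withDensity_ofReal hw.neg.2
  exact ae_eq_zero_of_withDensity_ofReal_eq hw.aemeasurable <|
    measure_eq_of_map_inner_eq_of_dense hG fun g hg =>
      map_withDensity_ofReal_eq_of_integral_mul_comp_eq_zero hw (by fun_prop) (h g hg)

theorem isGreatest_range_inner_closedBall {H : Type*} [NormedAddCommGroup H]
    [InnerProductSpace ℝ H] (m : H) :
    IsGreatest (Set.range fun f : Metric.closedBall (0 : H) 1 => inner ℝ m (f : H)) ‖m‖ := by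
  refine ⟨⟨⟨‖m‖⁻¹ • m, ?_⟩, ?_⟩, ?_⟩
  · rw [mem_closedBall_zero_iff, norm_smul, norm_inv, norm_norm]
    exact inv_mul_le_one
  · obtain rfl | hm := eq_or_ne m 0
    · simp
    · simp only [real_inner_smul_right, real_inner_self_eq_norm_sq]
      field_simp
  · rintro _ ⟨f, rfl⟩
    exact (real_inner_le_norm _ _).trans
      (mul_le_of_le_one_right (norm_nonneg _) (mem_closedBall_zero_iff.1 f.2))

section FeatureMap

variable {X : Type*} {H : Type*} [NormedAddCommGroup H] [InnerProductSpace ℝ H] [CompleteSpace H]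
  [RKHS ℝ H X ℝ]

variable (H) in
/-- The canonical feature map `x ↦ k(x, ·)` of a reproducing kernel Hilbert space of real
functions: the representer of the evaluation at `x`. -/
noncomputable def featureMap (x : X) : H :=
  RKHS.kerFun H x 1

@[simp]
theorem inner_featureMap_left (x : X) (f : H) : inner ℝ (featureMap H x) f = f x := by
  simp [featureMap]

@[simp]
theorem inner_featureMap_right (x : X) (f : H) : inner ℝ f (featureMap H x) = f x := by
  rw [real_inner_comm, inner_featureMap_left]

end FeatureMap

section ScalarRKHS

variable {H : Type*} [NormedAddCommGroup H] [InnerProductSpace ℝ H] [CompleteSpace H]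
  [RKHS ℝ H ℝ ℝ]

theorem featureMap_apply (s t : ℝ) : featureMap H t s = scalarKernel H s t := by
  rw [featureMap, RKHS.kerFun_apply, scalarKernel]

theorem inner_featureMap_featureMap (s t : ℝ) :
    inner ℝ (featureMap H s) (featureMap H t) = scalarKernel H s t := by
  rw [inner_featureMap_left, featureMap_apply]

theorem differentiable_featureMap (hk : ContDiff ℝ 2 (scalarKernel H).uncurry) :
    Differentiable ℝ (featureMap H) :=
  differentiable_of_contDiff_inner (by simpa only [inner_featureMap_featureMap] using hk)

theorem exists_norm_featureMap_le (hk : BddAbove (Set.range fun t => scalarKernel H t t)) :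
    ∃ C, ∀ t, ‖featureMap H t‖ ≤ C := by
  obtain ⟨M, hM⟩ := hk
  refine ⟨√M, fun t => Real.le_sqrt_of_sq_le ?_⟩
  rw [← real_inner_self_eq_norm_sq, inner_featureMap_featureMap]
  exact hM ⟨t, rfl⟩

theorem hasDerivAt_inner_featureMap (hκ : Differentiable ℝ (featureMap H)) (f : H) (t : ℝ) :
    HasDerivAt f (inner ℝ (deriv (featureMap H) t) f) t := by
  simpa using (hκ t).hasDerivAt.inner ℝ (hasDerivAt_const t f)

end ScalarRKHS

section Density

variable {D : ℕ} {p q : Euc D → ℝ}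

namespace IsDiffPosDensity

theorem measurable_ofReal (hq : IsDiffPosDensity q) : Measurable fun x => ENNReal.ofReal (q x) :=
  hq.differentiable.continuous.measurable.ennreal_ofReal

theorem isProbabilityMeasure_densityMeasure (hq : IsDiffPosDensity q) :
    IsProbabilityMeasure (densityMeasure q) := by
  refine ⟨?_⟩
  rw [densityMeasure, withDensity_apply _ MeasurableSet.univ, setLIntegral_univ,
    ← ofReal_integral_eq_lintegral_ofReal hq.integrable
      (.of_forall fun x => (hq.pos x).le), hq.integral_eq_one, ENNReal.ofReal_one]

theorem ae_densityMeasure_iff (hq : IsDiffPosDensity q) {P : Euc D → Prop} :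
    (∀ᵐ x ∂(densityMeasure q), P x) ↔ ∀ᵐ x, P x := by
  simp [densityMeasure, ae_withDensity_iff hq.measurable_ofReal, hq.pos]

theorem integral_densityMeasure (hq : IsDiffPosDensity q) {F : Type*} [NormedAddCommGroup F]
    [NormedSpace ℝ F] (f : Euc D → F) : ∫ x, f x ∂(densityMeasure q) = ∫ x, q x • f x := by
  rw [densityMeasure, integral_withDensity_eq_integral_toReal_smul hq.measurable_ofReal
    (.of_forall fun _ => ENNReal.ofReal_lt_top)]
  simp only [ENNReal.toReal_ofReal (hq.pos _).le]

theorem ae_eq_iff_eq (hp : IsDiffPosDensity p) (hq : IsDiffPosDensity q) :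
    p =ᵐ[volume] q ↔ p = q :=
  hp.differentiable.continuous.ae_eq_iff_eq volume hq.differentiable.continuous

theorem eq_of_eq_const_mul (hp : IsDiffPosDensity p) (hq : IsDiffPosDensity q) {c : ℝ}
    (h : ∀ x, p x = c * q x) : p = q := by
  have hc : c = 1 := by
    rw [← hp.integral_eq_one, funext h, integral_const_mul, hq.integral_eq_one, mul_one]
  funext x
  rw [h, hc, one_mul]

theorem differentiable_log (hp : IsDiffPosDensity p) : Differentiable ℝ fun x => Real.log (p x) :=
  hp.differentiable.log fun x => (hp.pos x).ne'

end IsDiffPosDensity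

theorem projScore_eq_fderiv_log (p : Euc D → ℝ) (r : USphere D) (x : Euc D) :
    projScore p r x = fderiv ℝ (fun y => Real.log (p y)) x r := by
  rw [projScore, score, gradient, InnerProductSpace.toDual_symm_apply]

theorem measurable_projScore (p : Euc D → ℝ) (r : USphere D) : Measurable (projScore p r) := by
  rw [funext (projScore_eq_fderiv_log p r)]
  exact measurable_fderiv_apply_const ℝ _ _

namespace IsDiffPosDensity

theorem mul_projScore (hp : IsDiffPosDensity p) (r : USphere D) (x : Euc D) :
    p x * projScore p r x = fderiv ℝ p x r := by
  rw [projScore_eq_fderiv_log, fderiv.log (hp.differentiable x) (hp.pos x).ne', smul_apply,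
    smul_eq_mul, mul_inv_cancel_left₀ (hp.pos x).ne']

theorem eq_of_score_ae_eq (hp : IsDiffPosDensity p) (hq : IsDiffPosDensity q)
    (h : score p =ᵐ[volume] score q) : p = q := by
  have hconst (x : Euc D) : Real.log (p x) - Real.log (q x) = Real.log (p 0) - Real.log (q 0) := by
    refine eq_of_fderiv_ae_eq_zero (μ := volume)
      (hp.differentiable_log.sub hq.differentiable_log) (h.mono fun y hy => ?_) x 0
    rw [fderiv_sub (hp.differentiable_log y) (hq.differentiable_log y),
      (InnerProductSpace.toDual ℝ (Euc D)).symm.injective hy, sub_self, Pi.zero_apply]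
  refine hp.eq_of_eq_const_mul hq (c := Real.exp (Real.log (p 0) - Real.log (q 0))) fun x => ?_
  rw [← hconst x, Real.exp_sub, Real.exp_log (hp.pos x), Real.exp_log (hq.pos x),
    div_mul_cancel₀ _ (hq.pos x).ne']

theorem eq_of_projScore_basisDir_ae_eq (hp : IsDiffPosDensity p) (hq : IsDiffPosDensity q)
    (O : OrthonormalBasis (Fin D) ℝ (Euc D))
    (h : ∀ i, projScore p (basisDir O i) =ᵐ[volume] projScore q (basisDir O i)) : p = q := by
  refine hp.eq_of_score_ae_eq hq ?_
  filter_upwards [ae_all_iff.2 h] with x hx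
  exact InnerProductSpace.ext_inner_right_basis O.toBasis fun i => by
    simpa [projScore, basisDir] using hx i

theorem projScore_ae_eq_of_ae_integral_ridge_eq_zero (hq : IsDiffPosDensity q) {r : USphere D}
    (hs : Integrable (fun x => projScore p r x - projScore q r x) (densityMeasure q))
    (h : ∀ᵐ g : USphere D ∂(sphereUniform D), ∀ F : C₀(ℝ, ℝ),
      ∫ x, (projScore p r x - projScore q r x) * F (inner ℝ x (g : Euc D))
        ∂(densityMeasure q) = 0) :
    projScore p r =ᵐ[volume] projScore q r := by
  have := hq.isProbabilityMeasure_densityMeasure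
  have : Nontrivial (Euc D) := nontrivial_of_ne (r : Euc D) 0 (ne_zero_of_mem_unit_sphere r)
  have : (sphereUniform D).IsOpenPosMeasure :=
    Measure.isOpenPosMeasure_smul _ (ENNReal.inv_ne_zero.2 (measure_ne_top _ _))
  have hzero := ae_eq_zero_of_integral_mul_ridge_eq_zero hs (Measure.dense_of_ae h) fun _ hg => hg
  exact (hq.ae_densityMeasure_iff.1 hzero).mono fun x hx => sub_eq_zero.1 hx

end IsDiffPosDensity

end Density

section SteinClass

variable {D : ℕ} {q : Euc D → ℝ} {g : USphere D}

theorem inner_smul_sphere (t : ℝ) (g : USphere D) : inner ℝ (t • (g : Euc D)) (g : Euc D) = t := by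
  simp [real_inner_smul_left]

theorem bddAbove_diag_of_ridge {k : ℝ → ℝ → ℝ} (h : BddAbove (Set.range fun x : Euc D =>
    k (inner ℝ x (g : Euc D)) (inner ℝ x (g : Euc D)))) : BddAbove (Set.range fun t => k t t) := by
  refine h.mono ?_
  rintro _ ⟨t, rfl⟩
  exact ⟨t • (g : Euc D), by simp only [inner_smul_sphere]⟩

namespace KernelInSteinClass

variable {k : ℝ → ℝ → ℝ}

theorem contDiff_profile
    (h : KernelInSteinClass q fun x y => k (inner ℝ x (g : Euc D)) (inner ℝ y (g : Euc D))) :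
    ContDiff ℝ 2 k.uncurry := by
  have hline : ContDiff ℝ 2 fun z : ℝ × ℝ => (z.1 • (g : Euc D), z.2 • (g : Euc D)) := by fun_prop
  simpa [Function.uncurry_def, Function.comp_def, inner_smul_sphere] using h.1.comp hline

theorem inSteinClass_ridge
    (h : KernelInSteinClass q fun x y => k (inner ℝ x (g : Euc D)) (inner ℝ y (g : Euc D)))
    (t : ℝ) : InSteinClass q fun y => k (inner ℝ y (g : Euc D)) t := by
  simpa only [inner_smul_sphere] using (h.2 (t • (g : Euc D))).2

end KernelInSteinClass

end SteinClass

section SteinOp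

variable {D : ℕ} {q : Euc D → ℝ} {g : USphere D}

/-- The sliced Stein operator of `p` in the directions `r` and `g`, acting on profiles `f` on the
line. Profiles are vector valued, so that it applies to the feature map of a reproducing kernel
Hilbert space as well as to the members of that space. -/
noncomputable def steinOp {F : Type*} [NormedAddCommGroup F] [NormedSpace ℝ F] (p : Euc D → ℝ)
    (r g : USphere D) (f : ℝ → F) (x : Euc D) : F :=
  projScore p r x • f (inner ℝ x (g : Euc D))
    + inner ℝ (r : Euc D) (g : Euc D) • deriv f (inner ℝ x (g : Euc D))

section VectorValued

variable {F : Type*} [NormedAddCommGroup F] [NormedSpace ℝ F]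

theorem steinOp_sub_steinOp (p q : Euc D → ℝ) (r g : USphere D) (f : ℝ → F) (x : Euc D) :
    steinOp p r g f x - steinOp q r g f x =
      (projScore p r x - projScore q r x) • f (inner ℝ x (g : Euc D)) := by
  simp only [steinOp, add_sub_add_right_eq_sub, sub_smul]

theorem stronglyMeasurable_steinOp [CompleteSpace F] (p : Euc D → ℝ) (r g : USphere D)
    {f : ℝ → F} (hf : Continuous f) : StronglyMeasurable (steinOp p r g f) := by
  have hinner : Continuous fun x : Euc D => inner ℝ x (g : Euc D) := by fun_prop
  exact ((measurable_projScore p r).stronglyMeasurable.smul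
    (hf.comp hinner).stronglyMeasurable).add
    (((stronglyMeasurable_deriv f).comp_measurable hinner.measurable).const_smul _)

end VectorValued

theorem IsDiffPosDensity.mul_steinOp_eq_inner_gradient (hq : IsDiffPosDensity q) {f : ℝ → ℝ}
    (hf : Differentiable ℝ f) (r g : USphere D) (x : Euc D) :
    q x * steinOp q r g f x =
      inner ℝ (r : Euc D) (∇ (fun y => f (inner ℝ y (g : Euc D)) * q y) x) := by
  have hridge : HasFDerivAt (fun y : Euc D => f (inner ℝ y (g : Euc D)))
      (deriv f (inner ℝ x (g : Euc D)) • innerSL ℝ (g : Euc D)) x := by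
    refine (hf _).hasDerivAt.comp_hasFDerivAt x ?_
    simp_rw [real_inner_comm (g : Euc D)]
    exact (innerSL ℝ (g : Euc D)).hasFDerivAt
  rw [real_inner_comm, gradient, InnerProductSpace.toDual_symm_apply,
    fderiv_fun_mul hridge.differentiableAt (hq.differentiable x), hridge.fderiv]
  simp only [steinOp, add_apply, smul_apply, smul_eq_mul, innerSL_apply_apply,
    real_inner_comm (g : Euc D), ← hq.mul_projScore]
  ring

theorem IsDiffPosDensity.integral_steinOp_eq_zero (hq : IsDiffPosDensity q) {f : ℝ → ℝ}
    (hf : Differentiable ℝ f) (h : InSteinClass q fun y => f (inner ℝ y (g : Euc D)))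
    (r : USphere D) : ∫ x, steinOp q r g f x ∂(densityMeasure q) = 0 := by
  obtain ⟨-, hint, hzero⟩ := h
  simp only [hq.integral_densityMeasure, smul_eq_mul, hq.mul_steinOp_eq_inner_gradient hf]
  rw [integral_inner hint, hzero, inner_zero_right]

end SteinOp

section MeanEmbedding

variable {D : ℕ} {p q : Euc D → ℝ} {r g : USphere D} {H : Type*} [NormedAddCommGroup H]
  [InnerProductSpace ℝ H] [CompleteSpace H] [RKHS ℝ H ℝ ℝ]

theorem inner_steinOp_featureMap (hκ : Differentiable ℝ (featureMap H)) (p : Euc D → ℝ)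
    (r g : USphere D) (f : H) (x : Euc D) :
    inner ℝ f (steinOp p r g (featureMap H) x) = steinOp p r g f x := by
  simp only [steinOp, inner_add_right, real_inner_smul_right, inner_featureMap_right, smul_eq_mul,
    (hasDerivAt_inner_featureMap hκ f _).deriv, real_inner_comm f]

theorem steinKernel_eq_inner_steinOp (hκ : Differentiable ℝ (featureMap H)) (p : Euc D → ℝ)
    (r g : USphere D) (x y : Euc D) :
    steinKernel p r g (scalarKernel H) x y =
      inner ℝ (steinOp p r g (featureMap H) x) (steinOp p r g (featureMap H) y) := by
  have hleft (s t : ℝ) : deriv (fun s => scalarKernel H s t) s =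
      inner ℝ (deriv (featureMap H) s) (featureMap H t) := by
    rw [← (hasDerivAt_inner_featureMap hκ (featureMap H t) s).deriv,
      funext fun s => (featureMap_apply s t).symm]
  have hright (f : H) (t : ℝ) : deriv (fun t => inner ℝ f (featureMap H t)) t =
      inner ℝ f (deriv (featureMap H) t) := by
    simpa using ((hasDerivAt_const t f).inner ℝ (hκ t).hasDerivAt).deriv
  simp only [steinKernel, hleft]
  simp only [← inner_featureMap_featureMap, hright]
  simp only [steinOp, inner_add_left, inner_add_right, real_inner_smul_left,
    real_inner_smul_right]
  ring

theorem integrable_steinOp_featureMap {μ : Measure (Euc D)} [IsFiniteMeasure μ]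
    (hκ : Differentiable ℝ (featureMap H))
    (hfin : Integrable (fun x => steinKernel p r g (scalarKernel H) x x) μ) :
    Integrable (steinOp p r g (featureMap H)) μ := by
  have hmeas := (stronglyMeasurable_steinOp p r g hκ.continuous).aestronglyMeasurable (μ := μ)
  simp only [steinKernel_eq_inner_steinOp hκ, real_inner_self_eq_norm_sq] at hfin
  exact ((memLp_two_iff_integrable_sq_norm hmeas).2 hfin).integrable one_le_two

theorem inner_integral_steinOp_featureMap {μ : Measure (Euc D)}
    (hκ : Differentiable ℝ (featureMap H))
    (hint : Integrable (steinOp p r g (featureMap H)) μ) (f : H) :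
    inner ℝ (∫ x, steinOp p r g (featureMap H) x ∂μ) f = ∫ x, steinOp p r g f x ∂μ := by
  rw [real_inner_comm, ← integral_inner hint]
  simp only [inner_steinOp_featureMap hκ]

theorem IsDiffPosDensity.integral_steinOp_featureMap_eq_zero (hq : IsDiffPosDensity q)
    (hκ : Differentiable ℝ (featureMap H))
    (hint : Integrable (steinOp q r g (featureMap H)) (densityMeasure q))
    (hstein : ∀ t, InSteinClass q fun y => featureMap H t (inner ℝ y (g : Euc D))) :
    ∫ x, steinOp q r g (featureMap H) x ∂(densityMeasure q) = 0 := by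
  refine RKHS.ext (𝕜 := ℝ) fun t => ?_
  rw [← inner_featureMap_right, inner_integral_steinOp_featureMap hκ hint,
    RKHS.coe_zero, Pi.zero_apply]
  exact hq.integral_steinOp_eq_zero
    (fun s => (hasDerivAt_inner_featureMap hκ _ s).differentiableAt) (hstein t) r

theorem discSq_eq_norm_integral_steinOp_sq (hκ : Differentiable ℝ (featureMap H))
    (hint : Integrable (steinOp p r g (featureMap H)) (densityMeasure q)) :
    discSq q p r g H = ‖∫ x, steinOp p r g (featureMap H) x ∂(densityMeasure q)‖ ^ 2 := by
  rw [← (isGreatest_range_inner_closedBall _).csSup_eq]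
  simp only [inner_integral_steinOp_featureMap hκ hint]
  rfl

theorem integrable_smul_featureMap_ridge {μ : Measure (Euc D)} {w : Euc D → ℝ}
    (hw : Integrable w μ) (hκ : Continuous (featureMap H))
    (hbdd : BddAbove (Set.range fun t => scalarKernel H t t)) (g : Euc D) :
    Integrable (fun x => w x • featureMap H (inner ℝ x g)) μ := by
  obtain ⟨C, hC⟩ := exists_norm_featureMap_le hbdd
  have hridge : Continuous fun x : Euc D => featureMap H (inner ℝ x g) := by fun_prop
  exact hw.smul_bdd C hridge.aestronglyMeasurable (.of_forall fun _ => hC _)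

theorem IsDiffPosDensity.discSq_eq_norm_integral_projScore_sub_smul_sq (hq : IsDiffPosDensity q)
    (hs : Integrable (fun x => projScore p r x - projScore q r x) (densityMeasure q))
    (hstein : KernelInSteinClass q fun x y =>
      scalarKernel H (inner ℝ x (g : Euc D)) (inner ℝ y (g : Euc D)))
    (hbdd : BddAbove (Set.range fun t => scalarKernel H t t))
    (hfin : Integrable (fun x => steinKernel p r g (scalarKernel H) x x) (densityMeasure q)) :
    discSq q p r g H = ‖∫ x, (projScore p r x - projScore q r x) •
      featureMap H (inner ℝ x (g : Euc D)) ∂(densityMeasure q)‖ ^ 2 := by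
  have := hq.isProbabilityMeasure_densityMeasure
  have hκ := differentiable_featureMap hstein.contDiff_profile
  have hp_int := integrable_steinOp_featureMap hκ hfin
  have hdiff_int := integrable_smul_featureMap_ridge hs hκ.continuous hbdd (g : Euc D)
  simp only [← steinOp_sub_steinOp] at hdiff_int ⊢
  have hq_int : Integrable (steinOp q r g (featureMap H)) (densityMeasure q) := by
    exact (hp_int.sub hdiff_int).congr (.of_forall fun _ => sub_sub_cancel _ _)
  rw [integral_sub hp_int hq_int, hq.integral_steinOp_featureMap_eq_zero hκ hq_int
    (by simpa only [featureMap_apply] using hstein.inSteinClass_ridge), sub_zero,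
    discSq_eq_norm_integral_steinOp_sq hκ hp_int]

theorem IsDiffPosDensity.integral_projScore_sub_mul_eq_zero_of_discSq_eq_zero
    (hq : IsDiffPosDensity q)
    (hs : Integrable (fun x => projScore p r x - projScore q r x) (densityMeasure q))
    (hstein : KernelInSteinClass q fun x y =>
      scalarKernel H (inner ℝ x (g : Euc D)) (inner ℝ y (g : Euc D)))
    (hbdd : BddAbove (Set.range fun t => scalarKernel H t t))
    (hfin : Integrable (fun x => steinKernel p r g (scalarKernel H) x x) (densityMeasure q))
    (hdense : Dense {F : C₀(ℝ, ℝ) | ∃ f : H, ∀ t, F t = f t}) (h0 : discSq q p r g H = 0)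
    (F : C₀(ℝ, ℝ)) :
    ∫ x, (projScore p r x - projScore q r x) * F (inner ℝ x (g : Euc D))
      ∂(densityMeasure q) = 0 := by
  have hκ := differentiable_featureMap hstein.contDiff_profile
  have hembed := hq.discSq_eq_norm_integral_projScore_sub_smul_sq hs hstein hbdd hfin
  rw [h0, eq_comm, sq_eq_zero_iff, norm_eq_zero] at hembed
  refine integral_mul_zeroAtInfty_comp_eq_zero_of_dense hs (by fun_prop) hdense ?_ F
  rintro F ⟨f, hf⟩
  have hinner :=
    integral_inner (𝕜 := ℝ) (integrable_smul_featureMap_ridge hs hκ.continuous hbdd g) f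
  simpa only [hembed, inner_zero_right, real_inner_smul_right, inner_featureMap_right, hf]
    using hinner

end MeanEmbedding

theorem SKo_eq_zero_iff {D : ℕ} {O : OrthonormalBasis (Fin D) ℝ (Euc D)} {q p : Euc D → ℝ}
    {H : USphere D → USphere D → Type*} [∀ r g, NormedAddCommGroup (H r g)]
    [∀ r g, InnerProductSpace ℝ (H r g)] [∀ r g, RKHS ℝ (H r g) ℝ ℝ]
    (hmeas : ∀ i, AEMeasurable (fun g => discSq q p (basisDir O i) g (H (basisDir O i) g))
      (sphereUniform D)) :
    SKo O q p H = 0 ↔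
      ∀ i, ∀ᵐ g ∂(sphereUniform D), discSq q p (basisDir O i) g (H (basisDir O i) g) = 0 := by
  simp only [SKo, Finset.sum_eq_zero_iff, Finset.mem_univ, true_imp_iff,
    lintegral_eq_zero_iff' (hmeas _).ennreal_ofReal]
  refine forall_congr' fun i => Filter.eventually_congr (.of_forall fun g => ?_)
  rw [Pi.zero_apply, ENNReal.ofReal_eq_zero]
  exact (sq_nonneg _).ge_iff_eq'

theorem theorem3_general {D : ℕ} (p q : Euc D → ℝ)
    (H : USphere D → USphere D → Type*) [∀ r g, NormedAddCommGroup (H r g)]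
    [∀ r g, InnerProductSpace ℝ (H r g)] [∀ r g, CompleteSpace (H r g)]
    [∀ r g, RKHS ℝ (H r g) ℝ ℝ]
    (O : OrthonormalBasis (Fin D) ℝ (Euc D)) (hp : IsDiffPosDensity p) (hq : IsDiffPosDensity q)
    (hs : ∀ i, Integrable (fun x => projScore p (basisDir O i) x - projScore q (basisDir O i) x)
      (densityMeasure q))
    (hdense : ∀ i g, Dense {F : C₀(ℝ, ℝ) | ∃ f : H (basisDir O i) g, ∀ t, F t = f t})
    (hstein : ∀ i (g : USphere D), KernelInSteinClass q fun x y =>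
      scalarKernel (H (basisDir O i) g) (inner ℝ x (g : Euc D)) (inner ℝ y (g : Euc D)))
    (hbdd : ∀ i (g : USphere D), BddAbove (Set.range fun t =>
      scalarKernel (H (basisDir O i) g) t t))
    (hfin : ∀ i g, Integrable
      (fun x => steinKernel p (basisDir O i) g (scalarKernel (H (basisDir O i) g)) x x)
      (densityMeasure q))
    (hmeas : ∀ i, AEMeasurable (fun g => discSq q p (basisDir O i) g (H (basisDir O i) g))
      (sphereUniform D)) :
    SKo O q p H = 0 ↔ p = q := by
  rw [SKo_eq_zero_iff hmeas]
  constructor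
  · intro h
    refine hp.eq_of_projScore_basisDir_ae_eq hq O fun i =>
      hq.projScore_ae_eq_of_ae_integral_ridge_eq_zero (hs i) ?_
    filter_upwards [h i] with g hg
    exact hq.integral_projScore_sub_mul_eq_zero_of_discSq_eq_zero (hs i) (hstein i g) (hbdd i g)
      (hfin i g) (hdense i g) hg
  · rintro rfl i
    refine .of_forall fun g => ?_
    rw [hq.discSq_eq_norm_integral_projScore_sub_smul_sq (hs i) (hstein i g) (hbdd i g)
      (hfin i g)]
    simp

theorem theorem3 {D : ℕ} (p q : Euc D → ℝ)
    -- an RKHS of functions on the line for every pair of directions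
    (H : USphere D → USphere D → Type*) [∀ r g, NormedAddCommGroup (H r g)]
    [∀ r g, InnerProductSpace ℝ (H r g)] [∀ r g, CompleteSpace (H r g)]
    [∀ r g, RKHS ℝ (H r g) ℝ ℝ]
    (O : OrthonormalBasis (Fin D) ℝ (Euc D))
    -- the densities
    (hp : IsDiffPosDensity p) (hq : IsDiffPosDensity q)
    (hq0 : Tendsto q (cocompact (Euc D)) (𝓝 0))
    -- the score difference is in `L¹(q)` and in `L²(q)`
    (hs1 : ∀ r : USphere D, Integrable (fun x => projScore p r x - projScore q r x)
      (densityMeasure q))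
    (hs2 : ∀ r : USphere D, Integrable (fun x => (projScore p r x - projScore q r x) ^ 2)
      (densityMeasure q))
    -- the kernels
    (huniv : ∀ r g, IsC0Universal (H r g))
    (hstein : ∀ r g : USphere D, KernelInSteinClass q (fun x y =>
      scalarKernel (H r g) (inner ℝ x (g : Euc D)) (inner ℝ y (g : Euc D))))
    (hbdd : ∀ r g : USphere D, BddAbove (Set.range fun x : Euc D =>
      scalarKernel (H r g) (inner ℝ x (g : Euc D)) (inner ℝ x (g : Euc D))))
    -- finiteness of `E_q[h_{p,r,g}(x, x)]`
    (hfin : ∀ r g : USphere D, Integrable (fun x => steinKernel p r g (scalarKernel (H r g)) x x)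
      (densityMeasure q))
    -- the integral over `g` makes sense
    (hmeas : ∀ i, AEMeasurable (fun g => discSq q p (basisDir O i) g (H (basisDir O i) g))
      (sphereUniform D)) :
    SKo O q p H = 0 ↔ p =ᵐ[volume] q := by
  rw [hp.ae_eq_iff_eq hq]
  exact theorem3_general p q H O hp hq (fun _ => hs1 _) (fun _ g => (huniv _ g).2)
    (fun _ => hstein _) (fun _ g => bddAbove_diag_of_ridge (hbdd _ g)) (fun _ => hfin _) hmeas
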